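/- Let $q$ be a prime power, let $n\ge 2$ be an integer, and let $V$ be an $n$-dimensional vector space over the finite field $\mathbb{F}_q$. Write $\binom{n}{k}_q=\prod_{i=0}^{k-1}\frac{q^{n-i}-1}{q^{k-i}-1}$ for the Gaussian binomial coefficient, and let $G_q(n,2)$ be the set of all $2$-dimensional subspaces of $V$. For a family $\mathcal{F}\subseteq G_q(n,2)$ put $$\mathcal{I}(\mathcal{F})=\sum_{A\in\mathcal{F}}\sum_{B\in\mathcal{F}}\dim(A\cap B),\qquad \mathcal{MI}(\mathcal{F})=\max\{\mathcal{I}(\mathcal{G}) : \mathcal{G}\subseteq G_q(n,2),\ |\mathcal{G}|=|\mathcal{F}|\}.$$ (1) If $\mathcal{F}\subseteq G_q(n,2)$ has size $M=|\mathcal{F}|=\binom{n-1}{1}_q$, then $$\mathcal{MI}(\mathcal{F})=\frac{(q^{n-1}+q-2)(q^{n-1}-1)}{(q-1)^2},$$ and, with $k=2$, $$\mathcal{MI}(\mathcal{F})=\left(\frac{\binom{n}{k}_q}{M}-\binom{n}{1}_q\right)\frac{qM^2\binom{k}{1}_q\binom{n-k}{1}_q}{\binom{n}{1}_q\left(\binom{n}{1}_q-1\right)}+kM^2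 .$$ (2) For every $1$-dimensional subspace $L\subseteq V$, the full $1$-star $\mathcal{Y}=\{A\in G_q(n,2) : L\subseteq A\}$ satisfies $|\mathcal{Y}|=\binom{n-1}{1}_q$ and $\mathcal{I}(\mathcal{Y})=\mathcal{MI}(\mathcal{Y})$. -/

import Mathlib

open Module

noncomputable section

/-- The Gaussian binomial coefficient `∏_{i=0}^{k-1} (q^(n-i) - 1) / (q^(k-i) - 1)`.
(For `n < k` the factor with `i = n` makes it `0`.) -/
def gaussBinom (q n k : ℕ) : ℝ :=
  ∏ i ∈ Finset.range k, ((q : ℝ) ^ (n - i) - 1) / ((q : ℝ) ^ (k - i) - 1)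

/-- The set of all `k`-dimensional subspaces of `V`. -/
def subspacesOfDim (K V : Type*) [Field K] [AddCommGroup V] [Module K V] (k : ℕ) :
    Set (Submodule K V) :=
  {U | finrank K U = k}

/-- The total intersection number `∑_{A ∈ F} ∑_{B ∈ F} dim (A ∩ B)` of a family of subspaces. -/
def totalIntersection {K V : Type*} [Field K] [AddCommGroup V] [Module K V]
    (F : Finset (Submodule K V)) : ℕ :=
  ∑ A ∈ F, ∑ B ∈ F, finrank K (A ⊓ B : Submodule K V)

/-- The total intersection numbers of the families `G ⊆ X` with `|G| = |F|`. -/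
def totalIntersectionValues {K V : Type*} [Field K] [AddCommGroup V] [Module K V]
    (X : Set (Submodule K V)) (F : Finset (Submodule K V)) : Set ℕ :=
  totalIntersection '' {G : Finset (Submodule K V) | (G : Set (Submodule K V)) ⊆ X ∧
    G.card = F.card}

/-- The maximal total intersection number among all families in `X` with the same size as `F`.
For finite `V` and `F ⊆ X` the supremum is a maximum, see `isGreatest_maxTotalIntersection`. -/
def maxTotalIntersection {K V : Type*} [Field K] [AddCommGroup V] [Module K V]
    (X : Set (Submodule K V)) (F : Finset (Submodule K V)) : ℕ :=
  sSup (totalIntersectionValues X F)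

theorem isGreatest_maxTotalIntersection {K V : Type*} [Field K] [AddCommGroup V] [Module K V]
    [Finite V] (X : Set (Submodule K V)) (F : Finset (Submodule K V))
    (hF : (F : Set (Submodule K V)) ⊆ X) :
    IsGreatest (totalIntersectionValues X F) (maxTotalIntersection X F) := by
  have hfin : (totalIntersectionValues X F).Finite := (Set.toFinite _).image _
  exact ⟨Nat.sSup_mem ⟨_, F, ⟨hF, rfl⟩, rfl⟩ hfin.bddAbove,
    fun _ ha => le_csSup hfin.bddAbove ha⟩

/-- The full star with centre `U`: the family of all `k`-dimensional subspaces containing `U`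
(a full `t`-star if `dim U = t`). -/
def fullStar {K V : Type*} [Field K] [AddCommGroup V] [Module K V] [Finite V]
    (k : ℕ) (U : Submodule K V) : Finset (Submodule K V) :=
  (Set.toFinite {A : Submodule K V | finrank K A = k ∧ U ≤ A}).toFinset

/-- The linear programming upper bound
`([n,k]/M - [n,1]) * (q M² [k,1] [n-k,1]) / ([n,1] ([n,1] - 1)) + k M²` on the total intersection
number of a family of `M` subspaces of dimension `k` of an `n`-dimensional space. -/
def intersectionBound (q n k M : ℕ) : ℝ :=
  (gaussBinom q n k / M - gaussBinom q n 1) *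
      ((q * (M : ℝ) ^ 2 * gaussBinom q k 1 * gaussBinom q (n - k) 1) /
        (gaussBinom q n 1 * (gaussBinom q n 1 - 1))) +
    k * (M : ℝ) ^ 2

end

/-!
Two distinct `(t + 1)`-dimensional subspaces meet in dimension at most `t`, so a family of `M` of
them has total intersection number at most `M (M t + 1)`. Members of a full star with a
`t`-dimensional centre always meet in dimension at least `t`, so every subfamily of such a star
attains this bound. The members of the star correspond to the points of the projective space of
the quotient by its centre, which gives their number. For `t = 1` the star has `M = [n-1,1]`
members, and the linear programming bound collapses to `M (M + 1)` through
`[n,2] = [n,1] [n-1,1] / [2,1]` and `[m+1,1] = q [m,1] + 1`.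
-/

section LinearAlgebra

variable {K V W : Type*} [DivisionRing K] [AddCommGroup V] [Module K V]
  [AddCommGroup W] [Module K W]

lemma finrank_comap_of_surjective [FiniteDimensional K V] {f : V →ₗ[K] W}
    (hf : Function.Surjective f) (H : Submodule K W) :
    finrank K (H.comap f) = finrank K H + finrank K f.ker := by
  have hrank := (f.domRestrict (H.comap f)).finrank_range_add_finrank_ker
  rw [LinearMap.range_domRestrict, LinearMap.ker_domRestrict,
    Submodule.map_comap_eq_of_surjective hf] at hrank
  rw [← hrank, (Submodule.comapSubtypeEquivOfLe (LinearMap.ker_le_comap f)).finrank_eq]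

lemma finrank_inf_lt_of_ne {A B : Submodule K V} [FiniteDimensional K A] [FiniteDimensional K B]
    (hfinrank : finrank K A = finrank K B) (hne : A ≠ B) :
    finrank K (A ⊓ B : Submodule K V) < finrank K A :=
  Submodule.finrank_lt_finrank_of_lt <|
    inf_lt_left.2 fun hle => hne (Submodule.eq_of_le_of_finrank_eq hle hfinrank)

end LinearAlgebra

section GaussBinom

variable {q : ℕ}

lemma gaussBinom_one_right (q n : ℕ) : gaussBinom q n 1 = ((q : ℝ) ^ n - 1) / ((q : ℝ) - 1) := by
  simp [gaussBinom]

lemma gaussBinom_one_right_eq_geom_sum (hq : q ≠ 1) (n : ℕ) :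
    gaussBinom q n 1 = ∑ i ∈ Finset.range n, (q : ℝ) ^ i := by
  rw [gaussBinom_one_right, geom_sum_eq (by exact_mod_cast hq)]

lemma gaussBinom_succ_one (hq : q ≠ 1) (n : ℕ) :
    gaussBinom q (n + 1) 1 = q * gaussBinom q n 1 + 1 := by
  rw [gaussBinom_one_right_eq_geom_sum hq, gaussBinom_one_right_eq_geom_sum hq, geom_sum_succ]

lemma gaussBinom_two_one (hq : q ≠ 1) : gaussBinom q 2 1 = q + 1 := by
  rw [gaussBinom_one_right_eq_geom_sum hq, geom_sum_two]

lemma gaussBinom_succ_succ (hq : q ≠ 1) (n k : ℕ) :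
    gaussBinom q (n + 1) (k + 1) =
      gaussBinom q (n + 1) 1 / gaussBinom q (k + 1) 1 * gaussBinom q n k := by
  have hq' : (q : ℝ) - 1 ≠ 0 := sub_ne_zero.2 (by exact_mod_cast hq)
  rw [gaussBinom_one_right, gaussBinom_one_right, div_div_div_cancel_right₀ hq', mul_comm]
  simp only [gaussBinom, Finset.prod_range_succ', Nat.add_sub_add_right, Nat.sub_zero]

lemma gaussBinom_nonneg (hq : 1 ≤ q) (n k : ℕ) : 0 ≤ gaussBinom q n k := by
  have hq' : (1 : ℝ) ≤ q := by exact_mod_cast hq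
  exact Finset.prod_nonneg fun i _ =>
    div_nonneg (sub_nonneg.2 (one_le_pow₀ hq')) (sub_nonneg.2 (one_le_pow₀ hq'))

lemma gaussBinom_one_mul_add_one (hq : q ≠ 1) (n : ℕ) :
    gaussBinom q n 1 * (gaussBinom q n 1 + 1) =
      ((q : ℝ) ^ n + q - 2) * ((q : ℝ) ^ n - 1) / ((q : ℝ) - 1) ^ 2 := by
  have hq' : (q : ℝ) - 1 ≠ 0 := sub_ne_zero.2 (by exact_mod_cast hq)
  rw [gaussBinom_one_right]
  field_simp
  ring

lemma intersectionBound_two_of_eq_gaussBinom (hq : 1 < q) {n M : ℕ} (hn : 2 ≤ n)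
    (hM : (M : ℝ) = gaussBinom q (n - 1) 1) :
    intersectionBound q n 2 M = M * (M + 1) := by
  obtain ⟨m, rfl⟩ := Nat.exists_eq_add_of_le' hn
  replace hM : (M : ℝ) = gaussBinom q (m + 1) 1 := hM
  have hR := gaussBinom_nonneg hq.le m 1
  have hMR : (M : ℝ) = q * gaussBinom q m 1 + 1 := hM.trans (gaussBinom_succ_one hq.ne' m)
  have hN : gaussBinom q (m + 2) 1 = q * M + 1 := by
    rw [hM, gaussBinom_succ_one hq.ne']
  have hNM : gaussBinom q (m + 2) 2 = (q * M + 1) / (q + 1) * M := by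
    rw [gaussBinom_succ_succ hq.ne' (m + 1) 1, hN, gaussBinom_two_one hq.ne', hM]
  have hM₀ : (0 : ℝ) < M := by rw [hMR]; positivity
  rw [intersectionBound, hNM, hN, gaussBinom_two_one hq.ne', Nat.add_sub_cancel,
    add_sub_cancel_right, Nat.cast_ofNat]
  calc
    _ = 2 * (M : ℝ) ^ 2 - M * (q * gaussBinom q m 1) := by
      field_simp
      ring
    _ = M * (M + 1) := by linear_combination M * hMR

end GaussBinom

section SubspaceFamilies

variable {K V : Type*} [Field K] [AddCommGroup V] [Module K V]

lemma mem_fullStar [Finite V] {k : ℕ} {U A : Submodule K V} :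
    A ∈ fullStar k U ↔ finrank K A = k ∧ U ≤ A := by
  simp [fullStar]

lemma fullStar_subset_subspacesOfDim [Finite V] (k : ℕ) (U : Submodule K V) :
    (fullStar k U : Set (Submodule K V)) ⊆ subspacesOfDim K V k :=
  fun _ hA => (mem_fullStar.1 hA).1

lemma card_fullStar_eq_card_quotient [Finite V] (L : Submodule K V) (j : ℕ) :
    (fullStar (j + finrank K L) L).card =
      Nat.card {H : Submodule K (V ⧸ L) // finrank K H = j} := by
  have hfinrank (H : Submodule K (V ⧸ L)) :
      finrank K H = j ↔ finrank K (H.comap L.mkQ) = j + finrank K L := by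
    rw [finrank_comap_of_surjective L.mkQ_surjective, Submodule.ker_mkQ, Nat.add_right_cancel_iff]
  have e₁ : {H : Submodule K (V ⧸ L) // finrank K H = j} ≃
      {A : Set.Ici L // finrank K A.1 = j + finrank K L} :=
    (Submodule.comapMkQRelIso L).toEquiv.subtypeEquiv hfinrank
  have e₂ : {A : Set.Ici L // finrank K A.1 = j + finrank K L} ≃ fullStar (j + finrank K L) L :=
    (Equiv.subtypeSubtypeEquivSubtypeInter (L ≤ ·) (finrank K · = j + finrank K L)).trans <|
      Equiv.subtypeEquivRight fun A => by rw [mem_fullStar, and_comm]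
  rw [← Nat.card_eq_finsetCard, Nat.card_congr (e₁.trans e₂)]

lemma card_fullStar_succ [Finite K] [Finite V] {t : ℕ} {L : Submodule K V}
    (hL : finrank K L = t) :
    ((fullStar (t + 1) L).card : ℝ) = gaussBinom (Nat.card K) (finrank K V - t) 1 := by
  have hquot : finrank K (V ⧸ L) = finrank K V - t := by
    have := L.finrank_quotient_add_finrank
    omega
  rw [add_comm, ← hL, card_fullStar_eq_card_quotient, hL,
    ← Nat.card_congr (Projectivization.equivSubmodule K (V ⧸ L)),
    Projectivization.card_of_finrank K _ hquot,
    gaussBinom_one_right_eq_geom_sum (Finite.one_lt_card (α := K)).ne']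
  push_cast
  rfl

lemma sum_sum_add_ite_eq {α : Type*} [DecidableEq α] (F : Finset α) (t : ℕ) :
    ∑ A ∈ F, ∑ B ∈ F, (t + if A = B then 1 else 0) = F.card * (F.card * t + 1) := by
  simp [Finset.sum_add_distrib, mul_add]

lemma finrank_inf_le_add_ite [FiniteDimensional K V] [DecidableEq (Submodule K V)] {t : ℕ}
    {A B : Submodule K V} (hA : finrank K A = t + 1) (hB : finrank K B = t + 1) :
    finrank K (A ⊓ B : Submodule K V) ≤ t + if A = B then 1 else 0 := by
  split_ifs with hAB
  · rw [← hAB, inf_idem, hA]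
  · have := finrank_inf_lt_of_ne (hA.trans hB.symm) hAB
    omega

lemma finrank_inf_eq_add_ite_of_mem_fullStar [Finite V] [DecidableEq (Submodule K V)] {t : ℕ}
    {L A B : Submodule K V} (hL : finrank K L = t) (hA : A ∈ fullStar (t + 1) L)
    (hB : B ∈ fullStar (t + 1) L) :
    finrank K (A ⊓ B : Submodule K V) = t + if A = B then 1 else 0 := by
  obtain ⟨hA, hLA⟩ := mem_fullStar.1 hA
  obtain ⟨hB, hLB⟩ := mem_fullStar.1 hB
  refine le_antisymm (finrank_inf_le_add_ite hA hB) ?_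
  split_ifs with hAB
  · rw [← hAB, inf_idem, hA]
  · rw [← hL]
    exact Submodule.finrank_mono (le_inf hLA hLB)

lemma totalIntersection_le [FiniteDimensional K V] {t : ℕ} {F : Finset (Submodule K V)}
    (hF : (F : Set (Submodule K V)) ⊆ subspacesOfDim K V (t + 1)) :
    totalIntersection F ≤ F.card * (F.card * t + 1) := by
  classical
  rw [← sum_sum_add_ite_eq]
  exact Finset.sum_le_sum fun A hA => Finset.sum_le_sum fun B hB =>
    finrank_inf_le_add_ite (hF hA) (hF hB)

lemma totalIntersection_of_subset_fullStar [Finite V] {t : ℕ} {L : Submodule K V}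
    (hL : finrank K L = t) {F : Finset (Submodule K V)} (hF : F ⊆ fullStar (t + 1) L) :
    totalIntersection F = F.card * (F.card * t + 1) := by
  classical
  rw [← sum_sum_add_ite_eq]
  exact Finset.sum_congr rfl fun A hA => Finset.sum_congr rfl fun B hB =>
    finrank_inf_eq_add_ite_of_mem_fullStar hL (hF hA) (hF hB)

lemma maxTotalIntersection_of_card_le_card_fullStar [Finite V] {t : ℕ} {L : Submodule K V}
    (hL : finrank K L = t) {F : Finset (Submodule K V)}
    (hF : (F : Set (Submodule K V)) ⊆ subspacesOfDim K V (t + 1))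
    (hcard : F.card ≤ (fullStar (t + 1) L).card) :
    maxTotalIntersection (subspacesOfDim K V (t + 1)) F = F.card * (F.card * t + 1) := by
  obtain ⟨S, hSL, hSF⟩ := Finset.exists_subset_card_eq hcard
  have hS : (S : Set (Submodule K V)) ⊆ subspacesOfDim K V (t + 1) :=
    (Finset.coe_subset.2 hSL).trans (fullStar_subset_subspacesOfDim (t + 1) L)
  refine (isGreatest_maxTotalIntersection _ F hF).unique ⟨⟨S, ⟨hS, hSF⟩, ?_⟩, ?_⟩
  · rw [totalIntersection_of_subset_fullStar hL hSL, hSF]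
  · rintro _ ⟨G, ⟨hG, hGF⟩, rfl⟩
    exact hGF ▸ totalIntersection_le hG

end SubspaceFamilies

theorem mainTheorem6 {K V : Type*} [Field K] [Finite K] [AddCommGroup V] [Module K V] [Finite V]
    (q n : ℕ) (hq : Nat.card K = q) (hV : finrank K V = n) (hn : 2 ≤ n) :
    (∀ F : Finset (Submodule K V), (F : Set (Submodule K V)) ⊆ subspacesOfDim K V 2 →
      (F.card : ℝ) = gaussBinom q (n - 1) 1 →
        (maxTotalIntersection (subspacesOfDim K V 2) F : ℝ) =
            ((q : ℝ) ^ (n - 1) + q - 2) * ((q : ℝ) ^ (n - 1) - 1) / ((q : ℝ) - 1) ^ 2 ∧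
          (maxTotalIntersection (subspacesOfDim K V 2) F : ℝ) =
            intersectionBound q n 2 F.card) ∧
    (∀ L : Submodule K V, finrank K L = 1 →
      (fullStar 2 L : Set (Submodule K V)) ⊆ subspacesOfDim K V 2 ∧
        ((fullStar 2 L).card : ℝ) = gaussBinom q (n - 1) 1 ∧
        totalIntersection (fullStar 2 L) =
          maxTotalIntersection (subspacesOfDim K V 2) (fullStar 2 L)) := by
  subst hq hV
  have hq : 1 < Nat.card K := Finite.one_lt_card
  refine ⟨fun F hF hcard => ?_, fun L hL => ?_⟩
  · have : Nontrivial V := nontrivial_of_finrank_pos (R := K) (by omega)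
    obtain ⟨v, hv⟩ := exists_ne (0 : V)
    have hL : finrank K (K ∙ v) = 1 := finrank_span_singleton hv
    have hcard_star : F.card = (fullStar 2 (K ∙ v)).card := by
      exact_mod_cast hcard.trans (card_fullStar_succ hL).symm
    have hmax : (maxTotalIntersection (subspacesOfDim K V 2) F : ℝ) = F.card * (F.card + 1) := by
      rw [maxTotalIntersection_of_card_le_card_fullStar hL hF hcard_star.le]
      push_cast
      rw [mul_one]
    refine ⟨?_, hmax.trans (intersectionBound_two_of_eq_gaussBinom hq hn hcard).symm⟩
    rw [hmax, hcard, gaussBinom_one_mul_add_one hq.ne']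
  · have hstar := fullStar_subset_subspacesOfDim 2 L
    refine ⟨hstar, card_fullStar_succ hL, ?_⟩
    rw [maxTotalIntersection_of_card_le_card_fullStar hL hstar le_rfl,
      totalIntersection_of_subset_fullStar hL subset_rfl]
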